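/- Let $\mathbb{E}$ be an arbitrary complex Banach space. For $d\in\mathbb{R}$ and $\alpha,r>0$ let $\hat S_d(\alpha,r)=\{\rho e^{i\varphi}:\rho>0,\ |\varphi-d|<\alpha/2\}\cup\{z\in\mathbb{C}:|z|<r\}$. For $k>0$, a holomorphic function $f:\hat S_d(\alpha,r)\to\mathbb{E}$ is of exponential growth of order at most $k$ if for all $\tilde\alpha\in(0,\alpha)$ and $\tilde r\in(0,r)$ there are $A,B>0$ such that $\|f(t)\|<Ae^{B|t|^k}$ for every $t\in\hat S_d(\tilde\alpha,\tilde r)$. A formal power series $\hat u=\sum_{n\ge0}u_nt^n\in\mathbb{E}[[t]]$ is called $k$-summable in the direction $d$ if, for some $\alpha,r>0$, the series $\sum_{n\ge0}\frac{u_n}{\Gamma(1+n/k)}t^n$ converges near $0$ and its sum continues analytically to a holomorphic function on $\hat S_d(\alpha,r)$ of exponential growth of order at most $k$. A sequence $m=(m(n))_{n\ge0}$ of positive real numbers preserves summability if for all $k>0$, all $d\in\mathbb{R}$ and all $\hat u=\sum_{n\ge0}u_nt^n\in\mathbb{E}[[t]]$, the series $\hat u$ is $k$-summable in the direction $d$ if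 and only if $\sum_{n\ge0}\frac{u_n}{m(n)}t^n$ is $k$-summable in the direction $d$. Theorem. Let $l\ge1$, let $0<a_1<\dots<a_l$ be real numbers, and let $w_1,\dots,w_l$ be polynomials with complex coefficients such that $w_l(n)\neq0$ for every $n\in\mathbb{N}_0$. Assume that $m(n)=w_1(n)a_1^n+\dots+w_l(n)a_l^n$ is a positive real number for every $n\in\mathbb{N}_0$. Then the sequence $m=(m(n))_{n\ge0}$ preserves summability. -/

import Mathlib

open Filter Topology

noncomputable section

namespace SummabilityPreserving

/-- The sector `S_d(α)` in direction `d` with opening `α`. -/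
def sector (d α : ℝ) : Set ℂ :=
  {z | ∃ ρ φ : ℝ, 0 < ρ ∧ φ ∈ Set.Ioo (d - α / 2) (d + α / 2) ∧
    z = (ρ : ℂ) * Complex.exp ((φ : ℂ) * Complex.I)}

/-- The disc-sector `S_d(α) ∪ D_r`. -/
def discSector (d α r : ℝ) : Set ℂ :=
  sector d α ∪ Metric.ball 0 r

/-- Formal power series `∑ aₙ tⁿ` with coefficients in `E`, given by their coefficients. -/
abbrev FormalSeries (E : Type*) : Type _ := ℕ → E

variable {E : Type*} [NormedAddCommGroup E] [NormedSpace ℂ E]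

/-- The `m`-Borel operator `∑ aₙ tⁿ ↦ ∑ (aₙ / m(n)) tⁿ`. -/
def momentBorel (m : ℕ → ℝ) (u : FormalSeries E) : FormalSeries E :=
  fun n => ((m n : ℂ)⁻¹) • u n

/-- The sequence `Γ_{1/k} = (Γ(1 + n/k))ₙ`. -/
def gammaSeq (k : ℝ) : ℕ → ℝ :=
  fun n => Real.Gamma (1 + (n : ℝ) / k)

/-- `f` is holomorphic on the (open) disc-sector with parameters `d, α, r`, and of exponential
growth of order at most `k` as `t → ∞` there. -/
def IsHolomorphicExpGrowth (k d α r : ℝ) (f : ℂ → E) : Prop :=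
  DifferentiableOn ℂ f (discSector d α r) ∧
    ∀ α' ∈ Set.Ioo 0 α, ∀ r' ∈ Set.Ioo 0 r, ∃ A B : ℝ, 0 < A ∧ 0 < B ∧
      ∀ t ∈ discSector d α' r', ‖f t‖ < A * Real.exp (B * ‖t‖ ^ k)

/-- The formal series `u` converges near the origin, and its sum continues to a holomorphic
function of exponential growth of order at most `k` on the disc-sector. -/
def ContinuesWithExpGrowth (k d α r : ℝ) (u : FormalSeries E) : Prop :=
  ∃ f : ℂ → E, (∀ᶠ t in 𝓝 (0 : ℂ), HasSum (fun n : ℕ => t ^ n • u n) (f t)) ∧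
    IsHolomorphicExpGrowth k d α r f

/-- `u` is `k`-summable in the direction `d`. -/
def IsKSummable (k d : ℝ) (u : FormalSeries E) : Prop :=
  ∃ α r : ℝ, 0 < α ∧ 0 < r ∧ ContinuesWithExpGrowth k d α r (momentBorel (gammaSeq k) u)

/-- The sequence `m` preserves summability of formal power series with coefficients in `E`. -/
def PreservesSummability (E : Type*) [NormedAddCommGroup E] [NormedSpace ℂ E]
    (m : ℕ → ℝ) : Prop :=
  ∀ k : ℝ, 0 < k → ∀ d : ℝ, ∀ u : FormalSeries E,
    IsKSummable k d u ↔ IsKSummable k d (momentBorel m u)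

end SummabilityPreserving

end

/-!
Both Borel operators act diagonally on coefficients, so the claim is that multiplication and
division of the coefficients `vₙ` by `m n` preserve the property that `∑ vₙ tⁿ` continues to a
disc-sector in direction `d` with exponential growth of order at most `k`.

Take for `Ω` a narrow sector, thickened by a small radius `δ`. If `t ∈ Ω` and `0 < b < 1`, then `Ω`
contains the disc of radius `(1 - b) δ` about `b t` (`RadiallyThick`). On holomorphic functions on
`Ω` with `‖f t‖ ≤ K ‖t‖ ^ N exp (B ‖t‖ ^ k)` (`WeightedExpansion`), some diagonal operators are
bounded (`IsMultiplier`):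

* `b ^ n` for `0 < b ≤ 1`, acting by `f (b t)`, with norm `b ^ N`;
* `n b ^ n` for `0 < b < 1`, acting by `b t f' (b t)`: Cauchy's estimate loses a factor of order
  `1 + ‖t‖ / δ`, which the exponential weight regains, since it is evaluated at a contracted point.
  The norm does not depend on `N`;
* `1 / (n - μ)` for `N ≥ Re μ + 1`, acting by `∫₀¹ s ^ (-μ - 1) f (s t) ds`, with norm at most `1`.

Hence `w n * b ^ n` is a multiplier for every polynomial `w` and `0 < b < 1`, with norm tending to
`0` as `N → ∞`, and `1 / w n` is one for large `N` (`exists_eval_mul_pow_decay`,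
`exists_inv_eval`). Multiplication by `m n` is thus a multiplier up to a rescaling of the variable.
For division, write `m n = aₗ ^ n wₗ n (1 - q n)`, where `q n = -∑ (wᵢ n / wₗ n) (aᵢ / aₗ) ^ n`
over `i < l` has norm less than `1` for large `N`, and invert `1 - q n` by a Neumann series
(`inv_one_sub`). The finitely many coefficients below degree `N` form a polynomial, which has
exponential growth of any positive order.
-/

namespace SummabilityPreserving

variable {E : Type*} [NormedAddCommGroup E] [NormedSpace ℂ E]

/-! ### Regions, weighted expansions and multipliers -/

/-- Powers are dominated by `exp (c * x ^ k)`. -/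
theorem exists_pow_le_exp_rpow {k c : ℝ} (hk : 0 < k) (hc : 0 < c) (j : ℕ) :
    ∃ C : ℝ, 0 < C ∧ ∀ x : ℝ, 0 ≤ x → x ^ j ≤ C * Real.exp (c * x ^ k) := by
  obtain ⟨n, hn⟩ := exists_nat_ge ((j : ℝ) / k)
  have hjn : (j : ℝ) ≤ k * n := by
    rw [div_le_iff₀ hk] at hn
    linarith
  refine ⟨1 + n.factorial / c ^ n, by positivity, fun x hx => ?_⟩
  have hxk : 0 ≤ x ^ k := Real.rpow_nonneg hx k
  have h1 : 1 ≤ Real.exp (c * x ^ k) := Real.one_le_exp (by positivity)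
  rcases le_total x 1 with hx1 | hx1
  · calc x ^ j ≤ 1 := pow_le_one₀ hx hx1
      _ ≤ 1 * Real.exp (c * x ^ k) := by linarith
      _ ≤ _ := by
        gcongr
        exact le_add_of_nonneg_right (by positivity)
  · have h2 : (c * x ^ k) ^ n / n.factorial ≤ Real.exp (c * x ^ k) :=
      Real.pow_div_factorial_le_exp _ (by positivity) n
    calc x ^ j = x ^ (j : ℝ) := (Real.rpow_natCast x j).symm
      _ ≤ x ^ (k * n) := Real.rpow_le_rpow_of_exponent_le hx1 hjn
      _ = (x ^ k) ^ n := by rw [Real.rpow_mul hx, Real.rpow_natCast]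
      _ = n.factorial / c ^ n * ((c * x ^ k) ^ n / n.factorial) := by
        rw [mul_pow]
        field_simp
      _ ≤ n.factorial / c ^ n * Real.exp (c * x ^ k) := by gcongr
      _ ≤ _ := by
        gcongr
        exact le_add_of_nonneg_left zero_le_one

/-- An open region that contains, for each of its points `t` and each `b ∈ (0, 1)`, the disc of
radius `(1 - b) * δ` about `b * t`. A cone thickened by `δ` has this property; it leaves room for
Cauchy estimates after a contraction. -/
structure RadiallyThick (Ω : Set ℂ) (δ : ℝ) : Prop where
  isOpen : IsOpen Ω
  pos : 0 < δ
  mem : ∀ t ∈ Ω, ∀ b : ℝ, 0 < b → b < 1 → ∀ z : ℂ, ‖z - b * t‖ < (1 - b) * δ → z ∈ Ω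

theorem RadiallyThick.mul_mem {Ω : Set ℂ} {δ : ℝ} (hΩ : RadiallyThick Ω δ) {t : ℂ} (ht : t ∈ Ω)
    {b : ℝ} (hb : 0 < b) (hb1 : b ≤ 1) : (b : ℂ) * t ∈ Ω := by
  rcases hb1.lt_or_eq with hb1 | rfl
  · refine hΩ.mem t ht b hb hb1 _ ?_
    simpa using mul_pos (sub_pos.2 hb1) hΩ.pos
  · simpa using ht

/-- `f` is holomorphic on `Ω` with `‖f t‖ ≤ K ‖t‖ ^ N exp (B ‖t‖ ^ k)` there, and on the closed disc
of radius `ρ` it is the sum of the series `∑ vₙ tⁿ`, which starts in degree `N` and converges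
absolutely at `ρ`. -/
structure WeightedExpansion (Ω : Set ℂ) (k B ρ : ℝ) (N : ℕ) (K : ℝ) (f : ℂ → E) (v : ℕ → E) :
    Prop where
  radius_pos : 0 < ρ
  nonneg : 0 ≤ K
  differentiableOn : DifferentiableOn ℂ f Ω
  bound : ∀ t ∈ Ω, ‖f t‖ ≤ K * (‖t‖ ^ N * Real.exp (B * ‖t‖ ^ k))
  eq_zero : ∀ n < N, v n = 0
  summable : Summable fun n => ρ ^ n * ‖v n‖
  hasSum : ∀ t : ℂ, ‖t‖ ≤ ρ → HasSum (fun n => t ^ n • v n) (f t)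

variable (E) in
/-- Multiplication of the `n`-th coefficient by `σ n` acts on weighted expansions that start in
degree `N`, with norm at most `C`. -/
structure IsMultiplier (Ω : Set ℂ) (k B ρ : ℝ) (N : ℕ) (C : ℝ) (σ : ℕ → ℂ) : Prop where
  nonneg : 0 ≤ C
  norm_le : ∀ n, N ≤ n → ‖σ n‖ ≤ C
  exists_expansion : ∀ (K : ℝ) (f : ℂ → E) (v : ℕ → E), WeightedExpansion Ω k B ρ N K f v →
    ∃ g : ℂ → E, WeightedExpansion Ω k B ρ N (C * K) g fun n => σ n • v n

theorem WeightedExpansion.summable_smul {Ω : Set ℂ} {k B ρ : ℝ} {N : ℕ} {K C : ℝ} {f : ℂ → E}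
    {v : ℕ → E} (h : WeightedExpansion Ω k B ρ N K f v) {σ : ℕ → ℂ}
    (hσ : ∀ n, N ≤ n → ‖σ n‖ ≤ C) : Summable fun n => ρ ^ n * ‖σ n • v n‖ := by
  have hρ := h.radius_pos
  refine Summable.of_nonneg_of_le (fun n => by positivity) (fun n => ?_) (h.summable.mul_left C)
  rcases lt_or_ge n N with hn | hn
  · simp [h.eq_zero n hn]
  · rw [norm_smul]
    calc ρ ^ n * (‖σ n‖ * ‖v n‖) ≤ ρ ^ n * (C * ‖v n‖) := by
          gcongr
          exact hσ n hn
      _ = _ := by ring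

theorem WeightedExpansion.smul_eq_zero {Ω : Set ℂ} {k B ρ : ℝ} {N : ℕ} {K : ℝ} {f : ℂ → E}
    {v : ℕ → E} (h : WeightedExpansion Ω k B ρ N K f v) (σ : ℕ → ℂ) :
    ∀ n < N, σ n • v n = 0 := fun n hn => by rw [h.eq_zero n hn, smul_zero]

namespace IsMultiplier

variable {Ω : Set ℂ} {k B ρ C C' : ℝ} {N : ℕ} {σ τ : ℕ → ℂ}

theorem congr (h : IsMultiplier E Ω k B ρ N C σ) (hστ : ∀ n, N ≤ n → σ n = τ n) :
    IsMultiplier E Ω k B ρ N C τ where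
  nonneg := h.nonneg
  norm_le n hn := hστ n hn ▸ h.norm_le n hn
  exists_expansion K f v hf := by
    obtain ⟨g, hg⟩ := h.exists_expansion K f v hf
    refine ⟨g, ?_⟩
    convert hg using 2 with n
    rcases lt_or_ge n N with hn | hn
    · simp [hf.eq_zero n hn]
    · rw [hστ n hn]

theorem mono (h : IsMultiplier E Ω k B ρ N C σ) (hC : C ≤ C') :
    IsMultiplier E Ω k B ρ N C' σ where
  nonneg := h.nonneg.trans hC
  norm_le n hn := (h.norm_le n hn).trans hC
  exists_expansion K f v hf := by
    obtain ⟨g, hg⟩ := h.exists_expansion K f v hf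
    have hK := hf.nonneg
    refine ⟨g, hf.radius_pos, mul_nonneg (h.nonneg.trans hC) hK, hg.differentiableOn, fun t ht => ?_, hg.eq_zero,
      hg.summable, hg.hasSum⟩
    exact (hg.bound t ht).trans (by gcongr)

theorem add (hσ : IsMultiplier E Ω k B ρ N C σ) (hτ : IsMultiplier E Ω k B ρ N C' τ) :
    IsMultiplier E Ω k B ρ N (C + C') fun n => σ n + τ n where
  nonneg := add_nonneg hσ.nonneg hτ.nonneg
  norm_le n hn := (norm_add_le _ _).trans (add_le_add (hσ.norm_le n hn) (hτ.norm_le n hn))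
  exists_expansion K f v hf := by
    obtain ⟨g, hg⟩ := hσ.exists_expansion K f v hf
    obtain ⟨h, hh⟩ := hτ.exists_expansion K f v hf
    refine ⟨fun t => g t + h t, hf.radius_pos,
      mul_nonneg (add_nonneg hσ.nonneg hτ.nonneg) hf.nonneg, hg.differentiableOn.add hh.differentiableOn,
      fun t ht => ?_, hf.smul_eq_zero _, ?_, fun t ht => ?_⟩
    · refine (norm_add_le _ _).trans ((add_le_add (hg.bound t ht) (hh.bound t ht)).trans ?_)
      exact le_of_eq (by ring)
    · refine Summable.of_norm_bounded (hg.summable.add hh.summable) fun n => ?_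
      rw [add_smul, norm_mul, norm_norm, norm_pow, Real.norm_eq_abs]
      have hρ := hf.radius_pos
      rw [abs_of_pos hρ, ← mul_add]
      gcongr
      exact norm_add_le _ _
    · simpa only [add_smul, smul_add] using (hg.hasSum t ht).add (hh.hasSum t ht)

theorem mul (hσ : IsMultiplier E Ω k B ρ N C σ) (hτ : IsMultiplier E Ω k B ρ N C' τ) :
    IsMultiplier E Ω k B ρ N (C * C') fun n => σ n * τ n where
  nonneg := mul_nonneg hσ.nonneg hτ.nonneg
  norm_le n hn := by
    rw [norm_mul]
    exact mul_le_mul (hσ.norm_le n hn) (hτ.norm_le n hn) (norm_nonneg _) hσ.nonneg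
  exists_expansion K f v hf := by
    obtain ⟨g, hg⟩ := hτ.exists_expansion K f v hf
    obtain ⟨h, hh⟩ := hσ.exists_expansion _ g _ hg
    exact ⟨h, by simpa only [mul_assoc, smul_smul] using hh⟩

theorem const (c : ℂ) : IsMultiplier E Ω k B ρ N ‖c‖ fun _ => c where
  nonneg := norm_nonneg c
  norm_le _ _ := le_rfl
  exists_expansion K f v hf := by
    refine ⟨fun t => c • f t, hf.radius_pos, mul_nonneg (norm_nonneg c) hf.nonneg,
      hf.differentiableOn.const_smul c, fun t ht => ?_, hf.smul_eq_zero _, ?_, fun t ht => ?_⟩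
    · rw [norm_smul, mul_assoc]
      exact mul_le_mul_of_nonneg_left (hf.bound t ht) (norm_nonneg c)
    · simpa only [norm_smul, mul_left_comm] using hf.summable.mul_left ‖c‖
    · simpa only [smul_comm c] using (hf.hasSum t ht).const_smul c

theorem pow (hσ : IsMultiplier E Ω k B ρ N C σ) (j : ℕ) :
    IsMultiplier E Ω k B ρ N (C ^ j) fun n => σ n ^ j := by
  induction j with
  | zero => simpa using const (E := E) (Ω := Ω) (k := k) (B := B) (ρ := ρ) (N := N) 1
  | succ j ih => simpa only [pow_succ] using ih.mul hσ

theorem sum {ι : Type*} (s : Finset ι) {D : ι → ℝ} {τ : ι → ℕ → ℂ}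
    (h : ∀ i ∈ s, IsMultiplier E Ω k B ρ N (D i) (τ i)) :
    IsMultiplier E Ω k B ρ N (∑ i ∈ s, D i) fun n => ∑ i ∈ s, τ i n := by
  classical
  induction s using Finset.induction_on with
  | empty => simpa using const (E := E) (Ω := Ω) (k := k) (B := B) (ρ := ρ) (N := N) 0
  | insert i s hi ih =>
    simp only [Finset.sum_insert hi]
    exact (h i (Finset.mem_insert_self i s)).add
      (ih fun j hj => h j (Finset.mem_insert_of_mem hj))

/-- Contraction of the variable by `b ≤ 1` multiplies the `n`-th coefficient by `b ^ n`; its norm is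
as small as desired when `b < 1` and `N` is large. -/
theorem const_pow {δ : ℝ} (hΩ : RadiallyThick Ω δ) (hk : 0 < k) (hB : 0 < B) {b : ℝ}
    (hb : 0 < b) (hb1 : b ≤ 1) : IsMultiplier E Ω k B ρ N (b ^ N) fun n => (b : ℂ) ^ n := by
  have hn : ∀ n, N ≤ n → ‖(b : ℂ) ^ n‖ ≤ b ^ N := fun n hn => by
    rw [norm_pow, Complex.norm_real, Real.norm_of_nonneg hb.le]
    exact pow_le_pow_of_le_one hb.le hb1 hn
  have hbt : ∀ t : ℂ, ‖(b : ℂ) * t‖ = b * ‖t‖ := fun t => by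
    rw [norm_mul, Complex.norm_real, Real.norm_of_nonneg hb.le]
  have hle : ∀ t : ℂ, b * ‖t‖ ≤ ‖t‖ := fun t => mul_le_of_le_one_left (norm_nonneg t) hb1
  refine ⟨by positivity, hn, fun K f v hf => ⟨fun t => f (b * t), ?_⟩⟩
  have hK := hf.nonneg
  refine ⟨hf.radius_pos, by positivity, ?_, fun t ht => ?_, hf.smul_eq_zero _, hf.summable_smul hn,
    fun t ht => ?_⟩
  · exact hf.differentiableOn.comp (by fun_prop) fun t ht => hΩ.mul_mem ht hb hb1
  · refine (hf.bound _ (hΩ.mul_mem ht hb hb1)).trans ?_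
    rw [hbt, mul_pow]
    calc K * (b ^ N * ‖t‖ ^ N * Real.exp (B * (b * ‖t‖) ^ k))
        ≤ K * (b ^ N * ‖t‖ ^ N * Real.exp (B * ‖t‖ ^ k)) := by
          gcongr
          exact hle t
      _ = _ := by ring
  · convert hf.hasSum (b * t) ((hbt t).trans_le ((hle t).trans ht)) using 2 with n
    rw [smul_smul, mul_pow, mul_comm]

end IsMultiplier

/-! ### Polynomial multipliers -/

namespace IsMultiplier

variable [CompleteSpace E]

variable {Ω : Set ℂ} {δ k B ρ C : ℝ} {N : ℕ} {σ : ℕ → ℂ}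

/-- The derivation `f ↦ b t f' (b t)` multiplies the `n`-th coefficient by `n b ^ n`. By Cauchy's
estimate it is bounded on a radially thick region, uniformly in `N`: the radius is at least
proportional to `min δ ‖t‖`, and the factor `‖t‖ / δ` lost for large `t` is absorbed by the growth
of `exp (B ‖t‖ ^ k)` between `(1 + b) / 2 * ‖t‖` and `‖t‖`. -/
theorem exists_natCast_mul_pow (hΩ : RadiallyThick Ω δ) (hk : 0 < k) (hB : 0 < B) {b : ℝ}
    (hb : 0 < b) (hb1 : b < 1) :
    ∃ C : ℝ, ∀ N, IsMultiplier E Ω k B ρ N C fun n => (n : ℂ) * (b : ℂ) ^ n := by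
  have hδ := hΩ.pos
  set b' : ℝ := (1 + b) / 2 with hb'
  have hb'0 : 0 < b' := by positivity
  have hb'1 : b' < 1 := by rw [hb']; linarith
  have hb'k : b' ^ k < 1 := Real.rpow_lt_one hb'0.le hb'1 hk
  have hc : 0 < B * (1 - b' ^ k) := mul_pos hB (sub_pos.2 hb'k)
  obtain ⟨M, hM0, hM⟩ := exists_pow_le_exp_rpow hk hc 1
  have h1b : 0 < 1 - b := sub_pos.2 hb1
  obtain ⟨C₁, hC₁⟩ : ∃ C₁ : ℝ, ∀ n : ℕ, ‖(n : ℂ) * (b : ℂ) ^ n‖ ≤ C₁ := by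
    obtain ⟨C₁, hC₁⟩ := (tendsto_self_mul_const_pow_of_lt_one hb.le hb1).bddAbove_range
    refine ⟨C₁, fun n => ?_⟩
    rw [norm_mul, norm_pow, Complex.norm_real, Real.norm_of_nonneg hb.le, Complex.norm_natCast]
    exact hC₁ ⟨n, rfl⟩
  set C₂ : ℝ := 2 / (1 - b) * (1 + M / δ) with hC₂
  have hC₂0 : 0 ≤ C₂ := by positivity
  refine ⟨max C₁ C₂, fun N => ⟨le_max_of_le_right hC₂0, fun n _ => le_max_of_le_left (hC₁ n),
    fun K f v hf => ⟨fun t => (b * t) • deriv f (b * t), ?_⟩⟩⟩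
  have hK := hf.nonneg
  have hbt : ∀ t : ℂ, ‖(b : ℂ) * t‖ = b * ‖t‖ := fun t => by
    rw [norm_mul, Complex.norm_real, Real.norm_of_nonneg hb.le]
  refine ⟨hf.radius_pos, by positivity, ?_, fun t ht => ?_, hf.smul_eq_zero _,
    hf.summable_smul fun n _ => hC₁ n, fun t ht => ?_⟩
  · refine DifferentiableOn.smul (by fun_prop) ?_
    exact (hf.differentiableOn.deriv hΩ.isOpen).comp (by fun_prop)
      fun t ht => hΩ.mul_mem ht hb hb1.le
  · rcases eq_or_ne t 0 with rfl | ht0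
    · simp only [mul_zero, zero_smul, norm_zero]
      positivity
    have htn : 0 < ‖t‖ := norm_pos_iff.2 ht0
    set R : ℝ := (1 - b) / 2 * min δ ‖t‖ with hR
    have hmin : 0 < min δ ‖t‖ := lt_min hδ htn
    have hR0 : 0 < R := by positivity
    have hsub : Metric.closedBall ((b : ℂ) * t) R ⊆ Ω := fun z hz => by
      refine hΩ.mem t ht b hb hb1 z ?_
      rw [mem_closedBall_iff_norm] at hz
      refine hz.trans_lt ?_
      calc R ≤ (1 - b) / 2 * δ := by
            rw [hR]
            gcongr
            exact min_le_left _ _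
        _ < (1 - b) * δ := by nlinarith
    have hderiv : ‖deriv f (b * t)‖ ≤
        K * (‖t‖ ^ N * Real.exp (B * (b' * ‖t‖) ^ k)) / R := by
      refine Complex.norm_deriv_le_of_forall_mem_sphere_norm_le hR0 ?_ fun z hz => ?_
      · refine (hf.differentiableOn.mono ?_).diffContOnCl
        rwa [closure_ball _ hR0.ne']
      · have hz' : ‖z‖ ≤ b' * ‖t‖ := by
          have h1 : ‖z - b * t‖ = R := mem_sphere_iff_norm.1 hz
          have h2 : ‖z‖ ≤ ‖(b : ℂ) * t‖ + ‖z - b * t‖ := by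
            simpa using norm_add_le ((b : ℂ) * t) (z - b * t)
          have h3 : R ≤ (1 - b) / 2 * ‖t‖ := by
            rw [hR]
            gcongr
            exact min_le_right _ _
          rw [hbt, h1] at h2
          calc ‖z‖ ≤ b * ‖t‖ + (1 - b) / 2 * ‖t‖ := by linarith
            _ = b' * ‖t‖ := by rw [hb']; ring
        refine (hf.bound z (hsub (Metric.sphere_subset_closedBall hz))).trans ?_
        gcongr
        exact hz'.trans (mul_le_of_le_one_left htn.le hb'1.le)
    have hratio : b * ‖t‖ / R ≤ 2 / (1 - b) * (1 + ‖t‖ / δ) := by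
      have h1 : ‖t‖ / min δ ‖t‖ ≤ 1 + ‖t‖ / δ := by
        rcases le_total δ ‖t‖ with h | h
        · rw [min_eq_left h]
          linarith
        · rw [min_eq_right h, div_self htn.ne']
          exact le_add_of_nonneg_right (by positivity)
      calc b * ‖t‖ / R = b * (2 / (1 - b) * (‖t‖ / min δ ‖t‖)) := by
            rw [hR]
            field_simp
        _ ≤ 1 * (2 / (1 - b) * (1 + ‖t‖ / δ)) := by gcongr
        _ = _ := one_mul _
    have habsorb : 1 + ‖t‖ / δ ≤ (1 + M / δ) * Real.exp (B * (1 - b' ^ k) * ‖t‖ ^ k) := by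
      have h1 := hM ‖t‖ htn.le
      rw [pow_one] at h1
      have h2 : 1 ≤ Real.exp (B * (1 - b' ^ k) * ‖t‖ ^ k) := Real.one_le_exp (by positivity)
      calc 1 + ‖t‖ / δ ≤ Real.exp (B * (1 - b' ^ k) * ‖t‖ ^ k) +
            M * Real.exp (B * (1 - b' ^ k) * ‖t‖ ^ k) / δ := by gcongr
        _ = _ := by ring
    rw [norm_smul, hbt]
    calc b * ‖t‖ * ‖deriv f (b * t)‖
        ≤ b * ‖t‖ * (K * (‖t‖ ^ N * Real.exp (B * (b' * ‖t‖) ^ k)) / R) := by gcongr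
      _ = b * ‖t‖ / R * (K * (‖t‖ ^ N * Real.exp (B * (b' * ‖t‖) ^ k))) := by ring
      _ ≤ 2 / (1 - b) * ((1 + M / δ) * Real.exp (B * (1 - b' ^ k) * ‖t‖ ^ k)) *
            (K * (‖t‖ ^ N * Real.exp (B * (b' * ‖t‖) ^ k))) := by
          gcongr
          exact hratio.trans (by gcongr)
      _ = C₂ * K * (‖t‖ ^ N * (Real.exp (B * (1 - b' ^ k) * ‖t‖ ^ k) *
            Real.exp (B * (b' * ‖t‖) ^ k))) := by rw [hC₂]; ring
      _ = C₂ * K * (‖t‖ ^ N * Real.exp (B * ‖t‖ ^ k)) := by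
          rw [← Real.exp_add, Real.mul_rpow hb'0.le htn.le]
          ring_nf
      _ ≤ _ := by
          gcongr
          exact le_max_right _ _
  · have hz : (b : ℂ) * t ∈ Metric.ball (0 : ℂ) ρ := by
      rw [mem_ball_zero_iff, hbt]
      calc b * ‖t‖ ≤ b * ρ := by gcongr
        _ < ρ := mul_lt_of_lt_one_left hf.radius_pos hb1
    have hsum := Complex.hasSum_deriv_of_summable_norm (F := fun n z => z ^ n • v n) hf.summable
      (fun n => by fun_prop) Metric.isOpen_ball (fun n w hw => ?_) hz
    · have heq : deriv (fun w : ℂ => ∑' n, w ^ n • v n) (b * t) = deriv f (b * t) := by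
        refine Filter.EventuallyEq.deriv_eq ?_
        filter_upwards [Metric.isOpen_ball.mem_nhds hz] with w hw
        exact (hf.hasSum w (mem_ball_zero_iff.1 hw).le).tsum_eq
      rw [heq] at hsum
      convert hsum.const_smul ((b : ℂ) * t) using 2 with n
      rw [deriv_smul_const (by fun_prop), smul_smul, smul_smul]
      congr 1
      rcases n with _ | n
      · simp
      · simp only [deriv_pow_field, Nat.add_sub_cancel]
        ring
    · rw [norm_smul, norm_pow]
      gcongr
      exact (mem_ball_zero_iff.1 hw).le

theorem exists_eval_mul_pow (hΩ : RadiallyThick Ω δ) (hk : 0 < k) (hB : 0 < B)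
    (w : Polynomial ℂ) {a : ℝ} (ha : 0 < a) (ha1 : a < 1) :
    ∃ C : ℝ, ∀ N, IsMultiplier E Ω k B ρ N C fun n => w.eval (n : ℂ) * (a : ℂ) ^ n := by
  induction w using Polynomial.induction_on generalizing a with
  | C c =>
    refine ⟨‖c‖ * 1, fun N => ?_⟩
    simpa only [Polynomial.eval_C] using (const c).mul
      ((const_pow hΩ hk hB ha ha1.le).mono (pow_le_one₀ ha.le ha1.le))
  | add p q hp hq =>
    obtain ⟨C₁, h₁⟩ := hp ha ha1
    obtain ⟨C₂, h₂⟩ := hq ha ha1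
    exact ⟨C₁ + C₂, fun N => by
      simpa only [Polynomial.eval_add, add_mul] using (h₁ N).add (h₂ N)⟩
  | monomial j c ih =>
    -- Half of the contraction is spent on the extra derivation.
    have hs : 0 < √a := Real.sqrt_pos.2 ha
    have hs1 : √a < 1 := (Real.sqrt_lt' one_pos).2 (by rwa [one_pow])
    obtain ⟨C₁, h₁⟩ := ih hs hs1
    obtain ⟨C₂, h₂⟩ := exists_natCast_mul_pow (E := E) (ρ := ρ) hΩ hk hB hs hs1
    refine ⟨C₁ * C₂, fun N => ((h₁ N).mul (h₂ N)).congr fun n _ => ?_⟩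
    have hsq : (a : ℂ) = (√a : ℂ) * (√a : ℂ) := by
      rw [← Complex.ofReal_mul, Real.mul_self_sqrt ha.le]
    simp only [Polynomial.eval_mul, Polynomial.eval_C, Polynomial.eval_pow, Polynomial.eval_X]
    rw [hsq, mul_pow]
    ring

/-- The norm of the multiplier `w n * a ^ n` decays geometrically in the starting degree. -/
theorem exists_eval_mul_pow_decay (hΩ : RadiallyThick Ω δ) (hk : 0 < k) (hB : 0 < B)
    (w : Polynomial ℂ) {a : ℝ} (ha : 0 < a) (ha1 : a < 1) :
    ∃ C : ℝ, ∀ N, IsMultiplier E Ω k B ρ N (C * √a ^ N)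
      fun n => w.eval (n : ℂ) * (a : ℂ) ^ n := by
  have hs : 0 < √a := Real.sqrt_pos.2 ha
  have hs1 : √a < 1 := (Real.sqrt_lt' one_pos).2 (by rwa [one_pow])
  obtain ⟨C, h⟩ := exists_eval_mul_pow (E := E) (ρ := ρ) hΩ hk hB w hs hs1
  refine ⟨C, fun N => ((h N).mul (const_pow hΩ hk hB hs hs1.le)).congr fun n _ => ?_⟩
  have hsq : (a : ℂ) = (√a : ℂ) * (√a : ℂ) := by
    rw [← Complex.ofReal_mul, Real.mul_self_sqrt ha.le]
  rw [hsq, mul_pow]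
  ring

/-! ### Inverting multipliers -/

/-- Neumann series: a multiplier of norm `C < 1` can be subtracted from `1` and inverted. -/
theorem inv_one_sub (hΩ : IsOpen Ω) (hk : 0 < k) (hB : 0 < B)
    (h : IsMultiplier E Ω k B ρ N C σ)
    (hC : C < 1) : IsMultiplier E Ω k B ρ N (1 - C)⁻¹ fun n => (1 - σ n)⁻¹ := by
  have hC0 := h.nonneg
  have h1C : 0 < 1 - C := sub_pos.2 hC
  have hn : ∀ n, N ≤ n → ‖(1 - σ n)⁻¹‖ ≤ (1 - C)⁻¹ := fun n hn => by
    rw [norm_inv]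
    refine inv_anti₀ h1C ?_
    calc 1 - C ≤ ‖(1 : ℂ)‖ - ‖σ n‖ := by
          rw [norm_one]
          linarith [h.norm_le n hn]
      _ ≤ _ := norm_sub_norm_le _ _
  refine ⟨by positivity, hn, fun K f v hf => ?_⟩
  choose g hg using fun j => (h.pow j).exists_expansion K f v hf
  have hK := hf.nonneg
  have hgeom := hasSum_geometric_of_lt_one hC0 hC
  refine ⟨fun t => ∑' j, g j t, hf.radius_pos, by positivity, fun t ht => ?_, fun t ht => ?_,
    hf.smul_eq_zero _, hf.summable_smul hn, fun t ht => ?_⟩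
  · -- On bounded parts of `Ω` the series converges uniformly.
    set U : Set ℂ := Ω ∩ Metric.ball 0 (‖t‖ + 1) with hU
    have hUo : IsOpen U := hΩ.inter Metric.isOpen_ball
    have htU : t ∈ U := ⟨ht, by simp⟩
    have hdiff : DifferentiableOn ℂ (fun w : ℂ => ∑' j, g j w) U := by
      refine Complex.differentiableOn_tsum_of_summable_norm
        (u := fun j => C ^ j * (K * ((‖t‖ + 1) ^ N * Real.exp (B * (‖t‖ + 1) ^ k))))
        (hgeom.summable.mul_right _) (fun j => (hg j).differentiableOn.mono fun z hz => hz.1)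
        hUo fun j w hw => ?_
      have hw1 : ‖w‖ ≤ ‖t‖ + 1 := (mem_ball_zero_iff.1 hw.2).le
      refine ((hg j).bound w hw.1).trans ?_
      rw [mul_assoc]
      gcongr
    exact (hdiff.differentiableAt (hUo.mem_nhds htU)).differentiableWithinAt
  · refine tsum_of_norm_bounded (hgeom.mul_right (K * (‖t‖ ^ N * Real.exp (B * ‖t‖ ^ k))))
      (fun j => ?_) |>.trans (le_of_eq (by ring))
    exact ((hg j).bound t ht).trans (le_of_eq (by ring))
  · -- Interchange of summation over `j` and `n`.
    have hsum : Summable fun p : ℕ × ℕ => t ^ p.2 • σ p.2 ^ p.1 • v p.2 := by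
      refine Summable.of_norm_bounded (hgeom.summable.mul_of_nonneg hf.summable
        (fun j => by positivity) fun n => ?_) fun p => ?_
      · have := hf.radius_pos
        positivity
      · rcases lt_or_ge p.2 N with hp | hp
        · simp [hf.eq_zero _ hp]
        · rw [norm_smul, norm_smul, norm_pow, norm_pow]
          calc ‖t‖ ^ p.2 * (‖σ p.2‖ ^ p.1 * ‖v p.2‖) ≤ ρ ^ p.2 * (C ^ p.1 * ‖v p.2‖) := by
                have := hf.radius_pos
                gcongr
                exact h.norm_le _ hp
            _ = _ := by ring
    have hS := hsum.hasSum
    have h1 := hS.prod_fiberwise fun j => (hg j).hasSum t ht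
    have h2 : HasSum (fun n => t ^ n • (1 - σ n)⁻¹ • v n) _ :=
      ((Equiv.prodComm ℕ ℕ).hasSum_iff.2 hS).prod_fiberwise fun n => by
        rcases lt_or_ge n N with hn | hn
        · simp [hf.eq_zero _ hn]
        · exact ((hasSum_geometric_of_norm_lt_one ((h.norm_le n hn).trans_lt hC)).smul_const
            (v n)).const_smul (t ^ n)
    rw [h1.tsum_eq]
    exact h2

end IsMultiplier

open MeasureTheory in
/-- The multiplier `1 / (n - μ)` is the operator `f ↦ ∫₀¹ s ^ (-μ - 1) f (s t) ds`. It has norm at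
most one once `N ≥ Re μ + 1`, because then `s ^ (-μ - 1)` is compensated by the factor `s ^ N` in
the bound for `f (s t)`. -/
theorem IsMultiplier.inv_natCast_sub [CompleteSpace E] {Ω : Set ℂ} {δ k B ρ : ℝ} {N : ℕ}
    (hΩ : RadiallyThick Ω δ) (hk : 0 < k) (hB : 0 < B) {μ : ℂ} (hN : μ.re + 1 ≤ N) :
    IsMultiplier E Ω k B ρ N 1 fun n => ((n : ℂ) - μ)⁻¹ := by
  have hre : ∀ n : ℕ, N ≤ n → 1 ≤ ((n : ℂ) - μ).re := fun n hn => by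
    have : (N : ℝ) ≤ n := by exact_mod_cast hn
    simp only [Complex.sub_re, Complex.natCast_re]
    linarith
  have hn : ∀ n : ℕ, N ≤ n → ‖((n : ℂ) - μ)⁻¹‖ ≤ 1 := fun n hn => by
    rw [norm_inv]
    exact inv_le_one_of_one_le₀ ((hre n hn).trans (Complex.re_le_norm _))
  refine ⟨zero_le_one, hn, fun K f v hf => ?_⟩
  have hK := hf.nonneg
  rw [one_mul]
  have hker : ∀ s ∈ Set.Ioc (0 : ℝ) 1, ‖(s : ℂ) ^ (-μ - 1)‖ * s ^ N ≤ 1 := fun s hs => by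
    rw [Complex.norm_cpow_eq_rpow_re_of_pos hs.1, ← Real.rpow_natCast s N, ← Real.rpow_add hs.1]
    refine Real.rpow_le_one hs.1.le hs.2 ?_
    simp only [Complex.sub_re, Complex.neg_re, Complex.one_re]
    linarith
  have hkerc : ∀ r : ℂ, ContinuousOn (fun s : ℝ => (s : ℂ) ^ r) (Set.Ioc 0 1) := fun r =>
    (Complex.continuous_ofReal.continuousOn).cpow_const fun s hs => Or.inl (by simpa using hs.1)
  have hmaps : ∀ t ∈ Ω, Set.MapsTo (fun s : ℝ => (s : ℂ) * t) (Set.Ioc 0 1) Ω := fun t ht s hs =>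
    hΩ.mul_mem ht hs.1 hs.2
  have hnorm : ∀ (s : ℝ) (t : ℂ), s ∈ Set.Ioc (0 : ℝ) 1 → ‖(s : ℂ) * t‖ = s * ‖t‖ :=
    fun s t hs => by rw [norm_mul, Complex.norm_real, Real.norm_of_nonneg hs.1.le]
  have hfs : ∀ t ∈ Ω, ∀ s ∈ Set.Ioc (0 : ℝ) 1,
      ‖f (s * t)‖ ≤ s ^ N * (K * (‖t‖ ^ N * Real.exp (B * ‖t‖ ^ k))) := fun t ht s hs => by
    refine (hf.bound _ (hmaps t ht hs)).trans ?_
    rw [hnorm s t hs, mul_pow]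
    have hs0 := hs.1.le
    calc K * (s ^ N * ‖t‖ ^ N * Real.exp (B * (s * ‖t‖) ^ k))
        ≤ K * (s ^ N * ‖t‖ ^ N * Real.exp (B * ‖t‖ ^ k)) := by
          gcongr
          exact mul_le_of_le_one_left (norm_nonneg t) hs.2
      _ = _ := by ring
  have hkf : ∀ t ∈ Ω, ∀ s ∈ Set.Ioc (0 : ℝ) 1, ‖(s : ℂ) ^ (-μ - 1) • f (s * t)‖ ≤
      K * (‖t‖ ^ N * Real.exp (B * ‖t‖ ^ k)) := fun t ht s hs => by
    rw [norm_smul]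
    calc _ ≤ ‖(s : ℂ) ^ (-μ - 1)‖ * (s ^ N * (K * (‖t‖ ^ N * Real.exp (B * ‖t‖ ^ k)))) := by
          gcongr
          exact hfs t ht s hs
      _ = ‖(s : ℂ) ^ (-μ - 1)‖ * s ^ N * (K * (‖t‖ ^ N * Real.exp (B * ‖t‖ ^ k))) := by ring
      _ ≤ 1 * (K * (‖t‖ ^ N * Real.exp (B * ‖t‖ ^ k))) := by
          gcongr
          exact hker s hs
      _ = _ := one_mul _
  have hmeas : ∀ t ∈ Ω, AEStronglyMeasurable (fun s : ℝ => (s : ℂ) ^ (-μ - 1) • f (s * t))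
      (volume.restrict (Set.Ioc 0 1)) := fun t ht =>
    ((hkerc _).smul (hf.differentiableOn.continuousOn.comp (by fun_prop)
      (hmaps t ht))).aestronglyMeasurable measurableSet_Ioc
  refine ⟨fun t => ∫ s in Set.Ioc (0 : ℝ) 1, (s : ℂ) ^ (-μ - 1) • f (s * t), hf.radius_pos, hK,
    fun t ht => ?_, fun t ht => ?_, hf.smul_eq_zero _, hf.summable_smul hn, fun t ht => ?_⟩
  · obtain ⟨ε, hε, hball⟩ := Metric.isOpen_iff.1 hΩ.isOpen t ht
    have hball2 : ∀ x ∈ Metric.ball t (ε / 2), Metric.closedBall x (ε / 4) ⊆ Ω := fun x hx y hy =>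
      hball (by
        rw [Metric.mem_ball] at *
        rw [Metric.mem_closedBall] at hy
        linarith [dist_triangle y x t])
    have hballΩ : ∀ x ∈ Metric.ball t (ε / 2), x ∈ Ω := fun x hx =>
      hball2 x hx (Metric.mem_closedBall_self (by positivity))
    set M : ℝ := K * ((‖t‖ + ε) ^ N * Real.exp (B * (‖t‖ + ε) ^ k)) with hM
    have hMb : ∀ y ∈ Metric.ball t ε, K * (‖y‖ ^ N * Real.exp (B * ‖y‖ ^ k)) ≤ M := fun y hy => by
      have : ‖y‖ ≤ ‖t‖ + ε := by
        have h1 := norm_sub_norm_le y t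
        have h2 := mem_ball_iff_norm.1 hy
        linarith
      rw [hM]
      gcongr
    have hder : ∀ s ∈ Set.Ioc (0 : ℝ) 1, ∀ x ∈ Metric.ball t (ε / 2),
        HasDerivAt (fun y : ℂ => f (s * y)) (deriv (fun y : ℂ => f (s * y)) x) x :=
      fun s hs x hx => by
        have hd : DifferentiableOn ℂ (fun y : ℂ => f (s * y)) Ω :=
          hf.differentiableOn.comp (by fun_prop) fun y hy => hmaps y hy hs
        exact (hd.differentiableAt (hΩ.isOpen.mem_nhds (hballΩ x hx))).hasDerivAt
    have key := hasDerivAt_integral_of_dominated_loc_of_deriv_le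
      (μ := volume.restrict (Set.Ioc (0 : ℝ) 1)) (x₀ := t) (s := Metric.ball t (ε / 2))
      (F := fun t s => (s : ℂ) ^ (-μ - 1) • f (s * t))
      (F' := fun t s => (s : ℂ) ^ (-μ - 1) • deriv (fun y : ℂ => f (s * y)) t)
      (bound := fun _ => M / (ε / 4)) (Metric.ball_mem_nhds t (by positivity)) ?_ ?_ ?_ ?_ ?_ ?_
    · exact key.2.differentiableAt.differentiableWithinAt
    · filter_upwards [hΩ.isOpen.mem_nhds ht] with x hx using hmeas x hx
    · exact Integrable.of_bound (hmeas t ht) _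
        ((ae_restrict_iff' measurableSet_Ioc).2 (ae_of_all _ fun s hs => hkf t ht s hs))
    · simp only [deriv_comp_mul_left]
      refine ContinuousOn.aestronglyMeasurable ?_ measurableSet_Ioc
      refine (hkerc _).smul (ContinuousOn.smul (by fun_prop) ?_)
      exact (hf.differentiableOn.deriv hΩ.isOpen).continuousOn.comp (by fun_prop) (hmaps t ht)
    · -- Cauchy's estimate in `x` for `f (s * x)` keeps the factor `s ^ N`.
      refine (ae_restrict_iff' measurableSet_Ioc).2 (ae_of_all _ fun s hs x hx => ?_)
      have hs0 := hs.1
      have hd : DifferentiableOn ℂ (fun y : ℂ => f (s * y)) Ω :=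
        hf.differentiableOn.comp (by fun_prop) fun y hy => hmaps y hy hs
      have hc : ‖deriv (fun y : ℂ => f (s * y)) x‖ ≤ s ^ N * M / (ε / 4) := by
        refine Complex.norm_deriv_le_of_forall_mem_sphere_norm_le (by positivity) ?_ fun z hz => ?_
        · refine (hd.mono ?_).diffContOnCl
          rw [closure_ball _ (by positivity)]
          exact hball2 x hx
        · refine (hfs z (hball2 x hx (Metric.sphere_subset_closedBall hz)) s hs).trans ?_
          gcongr
          refine hMb z ?_
          rw [Metric.mem_ball] at *
          rw [Metric.mem_sphere] at hz
          linarith [dist_triangle z x t]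
      have hM0 : 0 ≤ M := by positivity
      rw [norm_smul]
      calc _ ≤ ‖(s : ℂ) ^ (-μ - 1)‖ * (s ^ N * M / (ε / 4)) := by gcongr
        _ = ‖(s : ℂ) ^ (-μ - 1)‖ * s ^ N * (M / (ε / 4)) := by ring
        _ ≤ 1 * (M / (ε / 4)) := by
            gcongr
            exact hker s hs
        _ = _ := one_mul _
    · exact integrable_const _
    · refine (ae_restrict_iff' measurableSet_Ioc).2 (ae_of_all _ fun s hs x hx => ?_)
      exact (hder s hs x hx).const_smul _
  · refine (norm_setIntegral_le_of_norm_le_const (by simp) fun s hs => hkf t ht s hs).trans ?_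
    simp
  · have hF : ∀ n : ℕ, ∀ s ∈ Set.Ioc (0 : ℝ) 1,
        ‖(s : ℂ) ^ ((n : ℂ) - μ - 1) • t ^ n • v n‖ ≤ ρ ^ n * ‖v n‖ := fun n s hs => by
      rcases lt_or_ge n N with hnN | hnN
      · simp [hf.eq_zero n hnN]
      · rw [norm_smul, norm_smul, norm_pow]
        have h1 : ‖(s : ℂ) ^ ((n : ℂ) - μ - 1)‖ ≤ 1 := by
          rw [Complex.norm_cpow_eq_rpow_re_of_pos hs.1]
          refine Real.rpow_le_one hs.1.le hs.2 ?_
          rw [Complex.sub_re, Complex.one_re]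
          linarith [hre n hnN]
        calc _ ≤ 1 * (ρ ^ n * ‖v n‖) := by gcongr
          _ = _ := one_mul _
    have hint : ∀ n : ℕ, Integrable (fun s : ℝ => (s : ℂ) ^ ((n : ℂ) - μ - 1) • t ^ n • v n)
        (volume.restrict (Set.Ioc 0 1)) := fun n =>
      Integrable.of_bound (((hkerc _).smul continuousOn_const).aestronglyMeasurable
        measurableSet_Ioc) _ ((ae_restrict_iff' measurableSet_Ioc).2 (ae_of_all _ (hF n)))
    have key := hasSum_integral_of_summable_integral_norm hint
      (Summable.of_norm_bounded hf.summable fun n => by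
        refine (norm_setIntegral_le_of_norm_le_const (C := ρ ^ n * ‖v n‖) (by simp)
          fun s hs => ?_).trans (by simp)
        rw [norm_norm]
        exact hF n s hs)
    have hright : ∫ s in Set.Ioc (0 : ℝ) 1, ∑' n : ℕ, (s : ℂ) ^ ((n : ℂ) - μ - 1) • t ^ n • v n =
        ∫ s in Set.Ioc (0 : ℝ) 1, (s : ℂ) ^ (-μ - 1) • f (s * t) := by
      refine setIntegral_congr_fun measurableSet_Ioc fun s hs => ?_
      have hst : ‖(s : ℂ) * t‖ ≤ ρ := by
        rw [hnorm s t hs]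
        exact (mul_le_of_le_one_left (norm_nonneg t) hs.2).trans ht
      have hs0 : (s : ℂ) ≠ 0 := by exact_mod_cast hs.1.ne'
      refine HasSum.tsum_eq ?_
      convert (hf.hasSum _ hst).const_smul ((s : ℂ) ^ (-μ - 1)) using 2 with n
      rw [mul_pow, smul_smul, smul_smul, ← mul_assoc, ← Complex.cpow_natCast (s : ℂ) n,
        ← Complex.cpow_add _ _ hs0]
      ring_nf
    rw [hright] at key
    convert key using 2 with n
    rw [integral_smul_const, ← intervalIntegral.integral_of_le zero_le_one]
    rcases lt_or_ge n N with hnN | hnN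
    · simp [hf.eq_zero n hnN]
    · have h1 := hre n hnN
      have h0 : (n : ℂ) - μ ≠ 0 := fun h => by
        rw [h, Complex.zero_re] at h1
        linarith
      rw [integral_cpow (Or.inl (by rw [Complex.sub_re, Complex.one_re]; linarith)),
        sub_add_cancel, Complex.ofReal_one, Complex.one_cpow, Complex.ofReal_zero,
        Complex.zero_cpow h0, sub_zero, one_div, smul_comm]

/-- The inverse of a nonzero polynomial is a multiplier, uniformly in large starting degrees. -/
theorem IsMultiplier.exists_inv_eval [CompleteSpace E] {Ω : Set ℂ} {δ k B ρ : ℝ}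
    (hΩ : RadiallyThick Ω δ) (hk : 0 < k) (hB : 0 < B) (w : Polynomial ℂ) :
    ∃ (C : ℝ) (N₀ : ℕ), ∀ N, N₀ ≤ N →
      IsMultiplier E Ω k B ρ N C fun n => (w.eval (n : ℂ))⁻¹ := by
  have hroots : ∀ s : Multiset ℂ, ∃ N₀ : ℕ, ∀ N, N₀ ≤ N →
      IsMultiplier E Ω k B ρ N 1 fun n => ((s.map fun μ => (n : ℂ) - μ).prod)⁻¹ := fun s => by
    induction s using Multiset.induction_on with
    | empty =>
      refine ⟨0, fun N _ => ?_⟩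
      simpa using IsMultiplier.const (E := E) (Ω := Ω) (k := k) (B := B) (ρ := ρ) (N := N) 1
    | cons μ s ih =>
      obtain ⟨N₁, h₁⟩ := ih
      obtain ⟨N₂, h₂⟩ := exists_nat_ge (μ.re + 1)
      refine ⟨max N₁ N₂, fun N hN => ?_⟩
      have h3 : μ.re + 1 ≤ N := h₂.trans (by exact_mod_cast (le_max_right _ _).trans hN)
      simpa only [Multiset.map_cons, Multiset.prod_cons, mul_inv, one_mul] using
        (inv_natCast_sub hΩ hk hB h3).mul (h₁ N ((le_max_left _ _).trans hN))
  obtain ⟨N₀, h⟩ := hroots w.roots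
  refine ⟨‖w.leadingCoeff⁻¹‖ * 1, N₀, fun N hN => ?_⟩
  refine ((IsMultiplier.const w.leadingCoeff⁻¹).mul (h N hN)).congr fun n _ => ?_
  rw [(IsAlgClosed.splits w).eval_eq_prod_roots, mul_inv]

/-! ### Thickened sectors -/

theorem discSector_mono {d α α' r r' : ℝ} (hα : α ≤ α') (hr : r ≤ r') :
    discSector d α r ⊆ discSector d α' r' := by
  refine Set.union_subset_union ?_ (Metric.ball_subset_ball hr)
  rintro z ⟨x, φ, hx, hφ, rfl⟩
  exact ⟨x, φ, hx, ⟨by linarith [hφ.1], by linarith [hφ.2]⟩, rfl⟩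

theorem mul_mem_sector {d α b : ℝ} (hb : 0 < b) {z : ℂ} (hz : z ∈ sector d α) :
    (b : ℂ) * z ∈ sector d α := by
  obtain ⟨x, φ, hx, hφ, rfl⟩ := hz
  exact ⟨b * x, φ, mul_pos hb hx, hφ, by push_cast; ring⟩

/-- Every disc-sector contains a radially thick region that contains a smaller disc-sector: thicken
a narrower sector by a small radius. -/
theorem exists_radiallyThick (d : ℝ) {α r : ℝ} (hα : 0 < α) (hr : 0 < r) :
    ∃ (Ω : Set ℂ) (δ : ℝ), RadiallyThick Ω δ ∧ discSector d (α / 2) δ ⊆ Ω ∧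
      Ω ⊆ discSector d α r := by
  have harg : ∀ᶠ w in 𝓝 (1 : ℂ), |Complex.arg w| < α / 4 := by
    have h : Tendsto (fun w => |Complex.arg w|) (𝓝 (1 : ℂ)) (𝓝 |Complex.arg 1|) :=
      (Complex.continuousAt_arg Complex.one_mem_slitPlane).abs
    rw [Complex.arg_one, abs_zero] at h
    exact h.eventually (gt_mem_nhds (by positivity))
  obtain ⟨η, hη, hball⟩ := Metric.eventually_nhds_iff.1 harg
  -- This choice gives `δ / (r - δ) = η`.
  set δ : ℝ := r * η / (1 + η) with hδ
  have hδ0 : 0 < δ := by positivity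
  have hrδ : (r - δ) * η = δ := by
    rw [hδ]
    field_simp
    ring
  have hrδ0 : 0 < r - δ := pos_of_mul_pos_left (hδ0.trans_eq hrδ.symm) hη.le
  set S : Set ℂ := insert 0 (sector d (α / 2)) with hS
  have hSmul : ∀ s ∈ S, ∀ b : ℝ, 0 < b → (b : ℂ) * s ∈ S := by
    rintro s (rfl | hs) b hb
    · simp [hS]
    · exact Or.inr (mul_mem_sector hb hs)
  refine ⟨Metric.thickening δ S, δ, ⟨Metric.isOpen_thickening, hδ0, ?_⟩, ?_, ?_⟩
  · intro t ht b hb hb1 z hz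
    obtain ⟨s, hs, hts⟩ := Metric.mem_thickening_iff.1 ht
    refine Metric.mem_thickening_iff.2 ⟨b * s, hSmul s hs b hb, ?_⟩
    rw [dist_eq_norm] at hts ⊢
    have h1 : z - b * s = (z - b * t) + b * (t - s) := by ring
    have h2 : ‖(b : ℂ) * (t - s)‖ = b * ‖t - s‖ := by
      rw [norm_mul, Complex.norm_real, Real.norm_of_nonneg hb.le]
    calc ‖z - b * s‖ ≤ ‖z - b * t‖ + b * ‖t - s‖ := by
          rw [h1, ← h2]
          exact norm_add_le _ _
      _ < (1 - b) * δ + b * δ := by gcongr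
      _ = δ := by ring
  · rintro z (hz | hz)
    · exact Metric.self_subset_thickening hδ0 S (Or.inr hz)
    · exact Metric.mem_thickening_iff.2 ⟨0, Set.mem_insert _ _, hz⟩
  · intro z hz
    obtain ⟨s, hs, hzs⟩ := Metric.mem_thickening_iff.1 hz
    rw [dist_eq_norm] at hzs
    rcases lt_or_ge ‖z‖ r with hzr | hzr
    · exact Or.inr (mem_ball_zero_iff.2 hzr)
    have hsn : r - δ < ‖s‖ := by linarith [norm_sub_norm_le z s]
    have hs0 : s ≠ 0 := norm_pos_iff.1 (hrδ0.trans hsn)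
    have hz0 : z ≠ 0 := norm_pos_iff.1 (hr.trans_le hzr)
    have hw : |Complex.arg (z / s)| < α / 4 := by
      refine hball ?_
      rw [dist_eq_norm, div_sub_one hs0, norm_div, div_lt_iff₀ (norm_pos_iff.2 hs0)]
      nlinarith
    obtain ⟨x, φ, hx, hφ, hsx⟩ := hs.resolve_left hs0
    have hw' := abs_lt.1 hw
    refine Or.inl ⟨x * ‖z / s‖, φ + Complex.arg (z / s),
      mul_pos hx (norm_pos_iff.2 (div_ne_zero hz0 hs0)),
      ⟨by linarith [hφ.1, hw'.1], by linarith [hφ.2, hw'.2]⟩, ?_⟩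
    calc z = s * (z / s) := by field_simp
      _ = s * (‖z / s‖ * Complex.exp (Complex.arg (z / s) * Complex.I)) := by
          rw [Complex.norm_mul_exp_arg_mul_I]
      _ = _ := by
          nth_rewrite 1 [hsx]
          push_cast
          rw [add_mul, Complex.exp_add]
          ring

/-! ### Continuation in a direction -/

/-- A polynomial is bounded by any exponential of order `k > 0`. -/
theorem exists_norm_sum_pow_smul_le {k : ℝ} (hk : 0 < k) {B : ℝ} (hB : 0 < B)
    (v : ℕ → E) (N : ℕ) : ∃ A : ℝ, 0 ≤ A ∧
      ∀ t : ℂ, ‖∑ n ∈ Finset.range N, t ^ n • v n‖ ≤ A * Real.exp (B * ‖t‖ ^ k) := by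
  choose C hC0 hC using fun j => exists_pow_le_exp_rpow hk hB j
  refine ⟨∑ n ∈ Finset.range N, C n * ‖v n‖,
    Finset.sum_nonneg fun n _ => mul_nonneg (hC0 n).le (norm_nonneg _), fun t => ?_⟩
  rw [Finset.sum_mul]
  refine norm_sum_le_of_le _ fun n _ => ?_
  rw [norm_smul, norm_pow]
  calc ‖t‖ ^ n * ‖v n‖ ≤ C n * Real.exp (B * ‖t‖ ^ k) * ‖v n‖ := by
        gcongr
        exact hC n _ (norm_nonneg t)
    _ = _ := by ring

/-- The series `∑ vₙ tⁿ` continues to some disc-sector in direction `d` with exponential growth of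
order at most `k`; `u` is `k`-summable when its Borel transform has this property. -/
def ContinuesInDirection (k d : ℝ) (v : ℕ → E) : Prop :=
  ∃ α r : ℝ, 0 < α ∧ 0 < r ∧ ContinuesWithExpGrowth k d α r v

namespace ContinuesInDirection

variable {k d : ℝ} {v w : ℕ → E}

theorem add (hv : ContinuesInDirection k d v) (hw : ContinuesInDirection k d w) :
    ContinuesInDirection k d fun n => v n + w n := by
  obtain ⟨α₁, r₁, hα₁, hr₁, f, hf, hfd, hfg⟩ := hv
  obtain ⟨α₂, r₂, hα₂, hr₂, g, hg, hgd, hgg⟩ := hw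
  refine ⟨min α₁ α₂, min r₁ r₂, lt_min hα₁ hα₂, lt_min hr₁ hr₂, fun t => f t + g t, ?_, ?_, ?_⟩
  · filter_upwards [hf, hg] with t h1 h2
    simpa only [smul_add] using h1.add h2
  · exact (hfd.mono (discSector_mono (min_le_left _ _) (min_le_left _ _))).add
      (hgd.mono (discSector_mono (min_le_right _ _) (min_le_right _ _)))
  · intro α' hα' r' hr'
    obtain ⟨A₁, B₁, hA₁, hB₁, h₁⟩ := hfg α' ⟨hα'.1, hα'.2.trans_le (min_le_left _ _)⟩ r'
      ⟨hr'.1, hr'.2.trans_le (min_le_left _ _)⟩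
    obtain ⟨A₂, B₂, hA₂, hB₂, h₂⟩ := hgg α' ⟨hα'.1, hα'.2.trans_le (min_le_right _ _)⟩ r'
      ⟨hr'.1, hr'.2.trans_le (min_le_right _ _)⟩
    refine ⟨A₁ + A₂, B₁ + B₂, by positivity, by positivity, fun t ht => ?_⟩
    have hx : 0 ≤ ‖t‖ ^ k := Real.rpow_nonneg (norm_nonneg t) k
    calc ‖f t + g t‖ ≤ ‖f t‖ + ‖g t‖ := norm_add_le _ _
      _ < A₁ * Real.exp (B₁ * ‖t‖ ^ k) + A₂ * Real.exp (B₂ * ‖t‖ ^ k) :=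
          add_lt_add (h₁ t ht) (h₂ t ht)
      _ ≤ A₁ * Real.exp ((B₁ + B₂) * ‖t‖ ^ k) + A₂ * Real.exp ((B₁ + B₂) * ‖t‖ ^ k) := by
          gcongr <;> linarith
      _ = _ := by ring

/-- Rescaling of the variable. -/
theorem pow_smul (hv : ContinuesInDirection k d v) {a : ℝ} (ha : 0 < a) :
    ContinuesInDirection k d fun n => (a : ℂ) ^ n • v n := by
  obtain ⟨α, r, hα, hr, f, hf, hfd, hfg⟩ := hv
  have hnorm : ∀ t : ℂ, ‖(a : ℂ) * t‖ = a * ‖t‖ := fun t => by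
    rw [norm_mul, Complex.norm_real, Real.norm_of_nonneg ha.le]
  have hmaps : ∀ α' r' : ℝ, Set.MapsTo (fun t : ℂ => (a : ℂ) * t) (discSector d α' r')
      (discSector d α' (a * r')) := by
    rintro α' r' t (ht | ht)
    · exact Or.inl (mul_mem_sector ha ht)
    · refine Or.inr ?_
      rw [mem_ball_zero_iff] at ht ⊢
      rw [hnorm]
      gcongr
  refine ⟨α, r / a, hα, by positivity, fun t => f (a * t), ?_, ?_, ?_⟩
  · have h0 : Tendsto (fun t : ℂ => (a : ℂ) * t) (𝓝 0) (𝓝 0) :=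
      Continuous.tendsto' (by fun_prop) _ _ (mul_zero _)
    filter_upwards [h0.eventually hf] with t ht
    simpa only [mul_pow, smul_smul, mul_comm] using ht
  · refine hfd.comp (by fun_prop) ?_
    have := hmaps α (r / a)
    rwa [mul_div_cancel₀ _ ha.ne'] at this
  · intro α' hα' r' hr'
    obtain ⟨A, B, hA, hB, h⟩ := hfg α' hα' (a * r')
      ⟨mul_pos ha hr'.1, by rw [mul_comm]; exact (lt_div_iff₀ ha).1 hr'.2⟩
    refine ⟨A, B * a ^ k, hA, by positivity, fun t ht => (h _ (hmaps _ _ ht)).trans_eq ?_⟩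
    rw [hnorm, Real.mul_rpow ha.le (norm_nonneg t), mul_assoc]

theorem of_eq_zero (hk : 0 < k) {N : ℕ} (hv : ∀ n, N ≤ n → v n = 0) :
    ContinuesInDirection k d v := by
  obtain ⟨A, hA, h⟩ := exists_norm_sum_pow_smul_le hk one_pos v N
  refine ⟨1, 1, one_pos, one_pos, fun t => ∑ n ∈ Finset.range N, t ^ n • v n,
    Eventually.of_forall fun t => ?_, by fun_prop, fun α' _ r' _ =>
    ⟨A + 1, 1, by positivity, one_pos, fun t _ => (h t).trans_lt ?_⟩⟩
  · refine hasSum_sum_of_ne_finset_zero fun n hn => ?_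
    rw [hv n (by simpa using hn), smul_zero]
  · gcongr
    linarith

theorem of_weightedExpansion (hk : 0 < k) {Ω : Set ℂ} {B ρ : ℝ} {N : ℕ} {K : ℝ} {f : ℂ → E}
    (hf : WeightedExpansion Ω k B ρ N K f v) (hB : 0 < B) {α r : ℝ} (hα : 0 < α) (hr : 0 < r)
    (hΩ : discSector d α r ⊆ Ω) : ContinuesInDirection k d v := by
  obtain ⟨C, hC0, hC⟩ := exists_pow_le_exp_rpow hk one_pos N
  have hK := hf.nonneg
  refine ⟨α, r, hα, hr, f, ?_, hf.differentiableOn.mono hΩ, fun α' hα' r' hr' =>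
    ⟨K * C + 1, 1 + B, by positivity, by positivity, fun t ht => ?_⟩⟩
  · filter_upwards [Metric.closedBall_mem_nhds (0 : ℂ) hf.radius_pos] with t ht
    exact hf.hasSum t (mem_closedBall_zero_iff.1 ht)
  · have htΩ := hΩ (discSector_mono hα'.2.le hr'.2.le ht)
    calc ‖f t‖ ≤ K * (‖t‖ ^ N * Real.exp (B * ‖t‖ ^ k)) := hf.bound t htΩ
      _ ≤ K * (C * Real.exp (1 * ‖t‖ ^ k) * Real.exp (B * ‖t‖ ^ k)) := by
          gcongr
          exact hC _ (norm_nonneg t)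
      _ = K * C * Real.exp ((1 + B) * ‖t‖ ^ k) := by
          rw [add_mul, Real.exp_add]
          ring
      _ < _ := by
          gcongr
          linarith

/-- All the tails of a series that continues in direction `d` have weighted expansions on one and
the same region, with the same `B` and `ρ`. -/
theorem exists_weightedExpansion (hk : 0 < k) (hv : ContinuesInDirection k d v) :
    ∃ (Ω : Set ℂ) (δ α B ρ : ℝ), RadiallyThick Ω δ ∧ 0 < α ∧ discSector d α δ ⊆ Ω ∧ 0 < B ∧
      ∀ N : ℕ, ∃ (K : ℝ) (f : ℂ → E),
        WeightedExpansion Ω k B ρ N K f fun n => if n < N then 0 else v n := by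
  obtain ⟨α, r, hα, hr, f, hf, hfd, hfg⟩ := hv
  obtain ⟨A, B, hA, hB, hAB⟩ := hfg (α / 2) ⟨by positivity, by linarith⟩ (r / 2)
    ⟨by positivity, by linarith⟩
  obtain ⟨Ω, δ, hΩ, hsub, hsup⟩ := exists_radiallyThick d (half_pos hα) (half_pos hr)
  obtain ⟨R, hR, hball⟩ := Metric.eventually_nhds_iff.1 hf
  -- Convergence at `R / 2` gives absolute convergence at `R / 4`.
  set ρ : ℝ := R / 4 with hρ
  have hρ0 : 0 < ρ := by positivity
  have hsummable : Summable fun n => ρ ^ n * ‖v n‖ := by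
    have h1 : HasSum (fun n => ((2 * ρ : ℝ) : ℂ) ^ n • v n) (f ((2 * ρ : ℝ) : ℂ)) := hball (by
      rw [dist_zero_right, Complex.norm_real, Real.norm_of_nonneg (by positivity), hρ]
      linarith)
    obtain ⟨M, hM⟩ := h1.summable.tendsto_atTop_zero.norm.bddAbove_range
    refine Summable.of_nonneg_of_le (fun n => by positivity) (fun n => ?_)
      (summable_geometric_two.mul_left M)
    have h2 : ‖((2 * ρ : ℝ) : ℂ) ^ n • v n‖ ≤ M := hM ⟨n, rfl⟩
    rw [norm_smul, norm_pow, Complex.norm_real, Real.norm_of_nonneg (by positivity)] at h2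
    calc ρ ^ n * ‖v n‖ = (2 * ρ) ^ n * ‖v n‖ * (1 / 2) ^ n := by
          rw [mul_pow 2 ρ, one_div, inv_pow]
          field_simp
      _ ≤ M * (1 / 2) ^ n := by gcongr
  have hS0 : 0 ≤ ∑' n, ρ ^ n * ‖v n‖ := tsum_nonneg fun n => by positivity
  refine ⟨Ω, δ, α / 2 / 2, B, ρ, hΩ, by positivity, hsub, hB, fun N => ?_⟩
  obtain ⟨A', hA', hpoly⟩ := exists_norm_sum_pow_smul_le hk hB v N
  have hsum : ∀ t : ℂ, ‖t‖ ≤ ρ → HasSum (fun n => t ^ n • (if n < N then 0 else v n))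
      (f t - ∑ n ∈ Finset.range N, t ^ n • v n) := fun t ht => by
    have h1 : HasSum (fun n => t ^ n • v n) (f t) := hball (by
      rw [dist_zero_right]
      linarith)
    have h2 : HasSum (fun n => if n < N then t ^ n • v n else 0)
        (∑ n ∈ Finset.range N, if n < N then t ^ n • v n else 0) :=
      hasSum_sum_of_ne_finset_zero fun n hn => if_neg (by simpa using hn)
    rw [Finset.sum_congr rfl fun n hn => if_pos (Finset.mem_range.1 hn)] at h2
    convert h1.sub h2 using 2 with n
    split_ifs <;> simp
  refine ⟨(∑' n, ρ ^ n * ‖v n‖ + (A + A')) / ρ ^ N,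
    fun t => f t - ∑ n ∈ Finset.range N, t ^ n • v n, hρ0, by positivity, ?_, fun t ht => ?_,
    fun n hn => if_pos hn, ?_, hsum⟩
  · refine DifferentiableOn.sub (hfd.mono (hsup.trans ?_)) (by fun_prop)
    exact discSector_mono (by linarith) (by linarith)
  · have hexp : 1 ≤ Real.exp (B * ‖t‖ ^ k) := Real.one_le_exp (by positivity)
    rcases le_total ‖t‖ ρ with htρ | htρ
    · rw [← (hsum t htρ).tsum_eq]
      have h1 : ‖∑' n, t ^ n • (if n < N then 0 else v n)‖ ≤
          (‖t‖ / ρ) ^ N * ∑' n, ρ ^ n * ‖v n‖ := by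
        refine tsum_of_norm_bounded (hsummable.hasSum.mul_left _) fun n => ?_
        split_ifs with hn
        · rw [smul_zero, norm_zero]
          positivity
        · rw [norm_smul, norm_pow]
          have h2 : (‖t‖ / ρ) ^ n ≤ (‖t‖ / ρ) ^ N :=
            pow_le_pow_of_le_one (by positivity) ((div_le_one hρ0).2 htρ) (not_lt.1 hn)
          calc ‖t‖ ^ n * ‖v n‖ = (‖t‖ / ρ) ^ n * (ρ ^ n * ‖v n‖) := by
                rw [div_pow]
                field_simp
            _ ≤ _ := by gcongr
      calc _ ≤ (‖t‖ / ρ) ^ N * ∑' n, ρ ^ n * ‖v n‖ := h1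
        _ = (∑' n, ρ ^ n * ‖v n‖) / ρ ^ N * (‖t‖ ^ N * 1) := by
            rw [div_pow]
            ring
        _ ≤ _ := by
            gcongr
            exact le_add_of_nonneg_right (by positivity)
    · have h1 : ‖f t‖ ≤ A * Real.exp (B * ‖t‖ ^ k) := (hAB t (hsup ht)).le
      have h2 : 1 ≤ (‖t‖ / ρ) ^ N := one_le_pow₀ ((one_le_div hρ0).2 htρ)
      calc _ ≤ ‖f t‖ + ‖∑ n ∈ Finset.range N, t ^ n • v n‖ := norm_sub_le _ _
        _ ≤ A * Real.exp (B * ‖t‖ ^ k) + A' * Real.exp (B * ‖t‖ ^ k) := add_le_add h1 (hpoly t)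
        _ = 1 * ((A + A') * Real.exp (B * ‖t‖ ^ k)) := by ring
        _ ≤ (‖t‖ / ρ) ^ N * ((A + A') * Real.exp (B * ‖t‖ ^ k)) := by gcongr
        _ = (A + A') / ρ ^ N * (‖t‖ ^ N * Real.exp (B * ‖t‖ ^ k)) := by
            rw [div_pow]
            ring
        _ ≤ _ := by
            gcongr ?_ / _ * _
            exact le_add_of_nonneg_left hS0
  · refine Summable.of_nonneg_of_le (fun n => by positivity) (fun n => ?_) hsummable
    split_ifs
    · rw [norm_zero, mul_zero]
      positivity
    · exact le_rfl

end ContinuesInDirection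

/-! ### Exponential polynomials -/

/-- Multiplication of the coefficients by `a ^ n * σ n` preserves continuability if `σ` is a
multiplier for series that start in some degree `N`. -/
theorem ContinuesInDirection.smul {k d : ℝ} {v : ℕ → E} (hk : 0 < k)
    (hv : ContinuesInDirection k d v) {a : ℝ} (ha : 0 < a) {σ : ℕ → ℂ}
    (hσ : ∀ (Ω : Set ℂ) (δ B ρ : ℝ), RadiallyThick Ω δ → 0 < B →
      ∃ (N : ℕ) (C : ℝ), IsMultiplier E Ω k B ρ N C σ) :
    ContinuesInDirection k d fun n => (a : ℂ) ^ n • σ n • v n := by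
  obtain ⟨Ω, δ, α, B, ρ, hΩ, hα, hsub, hB, htail⟩ := hv.exists_weightedExpansion hk
  obtain ⟨N, C, hC⟩ := hσ Ω δ B ρ hΩ hB
  obtain ⟨K, f, hf⟩ := htail N
  obtain ⟨g, hg⟩ := hC.exists_expansion K f _ hf
  have h1 := ContinuesInDirection.of_weightedExpansion hk hg hB hα hΩ.pos hsub
  have h2 : ContinuesInDirection k d fun n => if n < N then σ n • v n else 0 :=
    .of_eq_zero hk (N := N) fun n hn => if_neg (not_lt.2 hn)
  refine ContinuesInDirection.pow_smul ?_ ha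
  convert h1.add h2 using 2 with n
  split_ifs <;> simp

/-- Exponential polynomials are multipliers after division by `a ^ n`, if `a` exceeds all the
bases. -/
theorem IsMultiplier.exists_sum_eval_mul_pow [CompleteSpace E] {Ω : Set ℂ} {δ k B ρ : ℝ}
    (hΩ : RadiallyThick Ω δ) (hk : 0 < k) (hB : 0 < B) {ι : Type*} [Fintype ι] (b : ι → ℝ)
    (w : ι → Polynomial ℂ) (hb : ∀ i, 0 < b i) (hb1 : ∀ i, b i < 1) :
    ∃ C : ℝ, IsMultiplier E Ω k B ρ 0 C fun n => ∑ i, (w i).eval (n : ℂ) * (b i : ℂ) ^ n := by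
  choose C hC using fun i =>
    exists_eval_mul_pow (E := E) (ρ := ρ) hΩ hk hB (w i) (hb i) (hb1 i)
  exact ⟨_, IsMultiplier.sum Finset.univ fun i _ => hC i 0⟩

/-- The inverse of `w₀ n + ∑ wᵢ n * bᵢ ^ n` with `bᵢ < 1` is a multiplier: factor out `w₀ n`, then
the remaining sum has small norm in large starting degrees. -/
theorem IsMultiplier.exists_inv_eval_add_sum [CompleteSpace E] {Ω : Set ℂ} {δ k B ρ : ℝ}
    (hΩ : RadiallyThick Ω δ) (hk : 0 < k) (hB : 0 < B) {ι : Type*} [Fintype ι] (b : ι → ℝ)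
    (w : ι → Polynomial ℂ) (hb : ∀ i, 0 < b i) (hb1 : ∀ i, b i < 1) (w₀ : Polynomial ℂ)
    (hw₀ : ∀ n : ℕ, w₀.eval (n : ℂ) ≠ 0) :
    ∃ (N : ℕ) (C : ℝ), IsMultiplier E Ω k B ρ N C
      fun n => (w₀.eval (n : ℂ) + ∑ i, (w i).eval (n : ℂ) * (b i : ℂ) ^ n)⁻¹ := by
  choose D hD using fun i =>
    exists_eval_mul_pow_decay (E := E) (ρ := ρ) hΩ hk hB (-w i) (hb i) (hb1 i)
  obtain ⟨C₀, N₀, hC₀⟩ := exists_inv_eval (E := E) (ρ := ρ) hΩ hk hB w₀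
  have hlim : Tendsto (fun N : ℕ => (∑ i, D i * √(b i) ^ N) * C₀) atTop (𝓝 0) := by
    have h : Tendsto (fun N : ℕ => ∑ i, D i * √(b i) ^ N) atTop (𝓝 (∑ i, D i * 0)) :=
      tendsto_finsetSum _ fun i _ => (tendsto_pow_atTop_nhds_zero_of_lt_one (Real.sqrt_nonneg _)
        ((Real.sqrt_lt' one_pos).2 (by simpa using hb1 i))).const_mul (D i)
    simpa using h.mul_const C₀
  obtain ⟨N, hN, hN₀⟩ := ((hlim.eventually (gt_mem_nhds one_pos)).and
    (eventually_ge_atTop N₀)).exists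
  have hq := ((IsMultiplier.sum Finset.univ fun i _ => hD i N).mul (hC₀ N hN₀)).inv_one_sub
    hΩ.isOpen hk hB hN
  refine ⟨N, _, ((hC₀ N hN₀).mul hq).congr fun n _ => ?_⟩
  rw [← mul_inv, mul_sub, mul_one, mul_left_comm, mul_inv_cancel₀ (hw₀ n), mul_one]
  simp only [Polynomial.eval_neg, neg_mul, Finset.sum_neg_distrib, sub_neg_eq_add]

end SummabilityPreserving

open SummabilityPreserving in
theorem theorem10 {E : Type*} [NormedAddCommGroup E] [NormedSpace ℂ E] [CompleteSpace E]
    (l : ℕ) (a : Fin (l + 1) → ℝ) (w : Fin (l + 1) → Polynomial ℂ) (m : ℕ → ℝ)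
    (ha_pos : ∀ i, 0 < a i) (ha_mono : StrictMono a)
    (hm_pos : ∀ n, 0 < m n)
    (hm : ∀ n : ℕ, (m n : ℂ) = ∑ i, (w i).eval (n : ℂ) * (a i : ℂ) ^ n)
    (hw : ∀ n : ℕ, (w (Fin.last l)).eval (n : ℂ) ≠ 0) :
    SummabilityPreserving.PreservesSummability E m := by
  intro k hk d u
  -- The two Borel operators commute, so only the continuation of the Borel transform matters.
  set v : ℕ → E := momentBorel (gammaSeq k) u with hv
  have hcomm : momentBorel (gammaSeq k) (momentBorel m u) = fun n => ((m n : ℂ)⁻¹) • v n := by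
    funext n
    exact smul_comm _ _ _
  change ContinuesInDirection k d v ↔
    ContinuesInDirection k d (momentBorel (gammaSeq k) (momentBorel m u))
  rw [hcomm]
  have hm0 : ∀ n, (m n : ℂ) ≠ 0 := fun n => by exact_mod_cast (hm_pos n).ne'
  set A : ℝ := a (Fin.last l) with hA
  have hA0 : 0 < A := ha_pos _
  have hAc : (A : ℂ) ≠ 0 := by exact_mod_cast hA0.ne'
  constructor
  · intro h
    have hlt : ∀ i : Fin l, a i.castSucc / A < 1 := fun i =>
      (div_lt_one hA0).2 (ha_mono (Fin.castSucc_lt_last i))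
    convert h.smul hk (inv_pos.2 hA0) fun Ω δ B ρ hΩ hB =>
      IsMultiplier.exists_inv_eval_add_sum hΩ hk hB (fun i : Fin l => a i.castSucc / A)
        (fun i => w i.castSucc) (fun i => div_pos (ha_pos _) hA0) hlt (w (Fin.last l)) hw
      using 2 with n
    rw [smul_smul, Complex.ofReal_inv, inv_pow, ← mul_inv, hm n, Fin.sum_univ_castSucc, mul_add,
      Finset.mul_sum, add_comm, mul_comm (Polynomial.eval _ _)]
    congr 3
    refine Finset.sum_congr rfl fun i _ => ?_
    rw [Complex.ofReal_div, div_pow]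
    field_simp
  · intro h
    -- Any base larger than all the `a i` makes the ratios smaller than one.
    have hlt : ∀ i, a i / (2 * A) < 1 := fun i => by
      rw [div_lt_one (by positivity)]
      linarith [ha_mono.monotone (Fin.le_last i)]
    convert h.smul hk (mul_pos two_pos hA0) fun Ω δ B ρ hΩ hB =>
      ⟨0, IsMultiplier.exists_sum_eval_mul_pow hΩ hk hB (fun i => a i / (2 * A)) w
        (fun i => div_pos (ha_pos _) (by positivity)) hlt⟩ using 2 with n
    have hmn : ((2 * A : ℝ) : ℂ) ^ n *
        ∑ i, (w i).eval (n : ℂ) * ((a i / (2 * A) : ℝ) : ℂ) ^ n = m n := by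
      rw [hm n, Finset.mul_sum]
      refine Finset.sum_congr rfl fun i _ => ?_
      push_cast
      rw [div_pow]
      field_simp
    rw [smul_smul, smul_smul, hmn, mul_inv_cancel₀ (hm0 n), one_smul]
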